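/- Let $\mathbb K$ be $\mathbb R$, $\mathbb C$ or the quaternions $\mathbb H$, and regard $\mathbb K^n$ as a right $\mathbb K$-vector space. Let $\mathcal M(n,\mathbb K)$ be the real vector space of $n\times n$ matrices over $\mathbb K$, let $A^*$ be the conjugate transpose of $A$, and let $O(n,\mathbb K)=\{A\in\mathcal M(n,\mathbb K): AA^*=I\}$ (so $O(n)$, $U(n)$ or $Sp(n)$). For $X\in\mathcal M(n,\mathbb K)$ let $h_X\colon O(n,\mathbb K)\to\mathbb R$, $h_X(A)=\operatorname{Re}\operatorname{Tr}(XA)$, and let $\Sigma(h_X)\subset O(n,\mathbb K)$ be its set of critical points. For $m\ge 0$ put $\Sigma(m)=\{A\in O(m,\mathbb K): A^2=I\}$. Theorem. Let $X\in\mathcal M(n,\mathbb K)$ be arbitrary. Let $n_0=\dim_{\mathbb K}\{v\in\mathbb K^n: Xv=0\}$, let $t_1<\dots<t_k$ ($k\ge 0$) be the nonzero (real) eigenvalues of the Hermitian matrix $XX^*$, and let $n_i=\dim_{\mathbb K}\{v\in\mathbb K^n: XX^*v=t_iv\}$ be their multiplicities. Then all $t_i$ are positive, $n_0+n_1+\dots+n_k=n$,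 the set $\Sigma(h_X)$ is a smooth embedded submanifold of $\mathcal M(n,\mathbb K)$ (whose components may have different dimensions), and there is a diffeomorphism $$\Sigma(h_X)\cong O(n_0,\mathbb K)\times\Sigma(n_1)\times\dots\times\Sigma(n_k),$$ where the right-hand side is regarded as a subset of $\mathcal M(n_0,\mathbb K)\times\mathcal M(n_1,\mathbb K)\times\dots\times\mathcal M(n_k,\mathbb K)$. That is, there is a bijection which, together with its inverse, is locally the restriction of smooth maps between open subsets of the ambient real vector spaces. -/

import Mathlib

open scoped Matrix ContDiff

/-! ### Smooth subsets of normed spaces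

The critical sets below usually have connected components of different dimensions, so they carry
no `ChartedSpace` structure over a single finite-dimensional model space. Submanifolds, smooth maps
and diffeomorphisms are therefore described through the ambient real vector space. -/

section SmoothSubsets

variable {E F : Type*} [NormedAddCommGroup E] [NormedSpace ℝ E]
  [NormedAddCommGroup F] [NormedSpace ℝ F]

/-- `S` is a smooth embedded submanifold of `E`: around each of its points there is a smooth chart
of `E` (with smooth inverse) which carries `S` to an open piece of a linear subspace. The dimension
of that subspace may depend on the point. -/
def IsEmbeddedSubmanifold (S : Set E) : Prop :=
  ∀ x ∈ S, ∃ φ : OpenPartialHomeomorph E E, ∃ V : Submodule ℝ E,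
    x ∈ φ.source ∧ ContDiffOn ℝ ∞ φ φ.source ∧ ContDiffOn ℝ ∞ φ.symm φ.target ∧
      φ '' (S ∩ φ.source) = (V : Set E) ∩ φ.target

/-- A map from a subset of `E` to `F` is smooth if, near each point of the subset, it is the
restriction of a smooth map defined on an open subset of `E`. -/
def IsSmoothOnSubset {S : Set E} (f : S → F) : Prop :=
  ∀ x : S, ∃ U : Set E, IsOpen U ∧ (x : E) ∈ U ∧
    ∃ g : E → F, ContDiffOn ℝ ∞ g U ∧ ∀ y : S, (y : E) ∈ U → g y = f y

/-- Two subsets of normed spaces are diffeomorphic if there is a bijection between them that is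
smooth in both directions. -/
def AreDiffeomorphic (S : Set E) (T : Set F) : Prop :=
  ∃ e : S ≃ T, IsSmoothOnSubset (fun x : S => (e x : F)) ∧
    IsSmoothOnSubset (fun y : T => (e.symm y : E))

/-- `x` is a critical point of the restriction of `f` to `M`: the derivative at time `0` of `f`
along every smooth curve in `M` that passes through `x` at time `0` vanishes. -/
def IsCriticalPointOn (f : E → ℝ) (M : Set E) (x : E) : Prop :=
  x ∈ M ∧ ∀ γ : ℝ → E, ContDiff ℝ ∞ γ → (∀ s, γ s ∈ M) → γ 0 = x →
    HasDerivAt (fun s => f (γ s)) 0 0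

end SmoothSubsets

/-! ### Matrices over the real, complex and quaternionic numbers -/

section Algebra

variable {𝕂 : Type*} [DivisionRing 𝕂]

/-- The kernel of `v ↦ X v`, as a right `𝕂`-subspace of `𝕂ⁿ`. -/
def rightKernel {n : ℕ} (X : Matrix (Fin n) (Fin n) 𝕂) : Submodule 𝕂ᵐᵒᵖ (Fin n → 𝕂) where
  carrier := {v | X *ᵥ v = 0}
  add_mem' := by
    intro v w hv hw
    change X *ᵥ v = 0 at hv
    change X *ᵥ w = 0 at hw
    change X *ᵥ (v + w) = 0
    rw [Matrix.mulVec_add, hv, hw, add_zero]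
  zero_mem' := Matrix.mulVec_zero X
  smul_mem' := by
    intro c v hv
    change X *ᵥ v = 0 at hv
    change X *ᵥ (c • v) = 0
    rw [Matrix.mulVec_smul, hv, smul_zero]

/-- The eigenspace `{v | A v = s v}` of `A` for a real number `s`, as a right `𝕂`-subspace
of `𝕂ⁿ`. -/
def realEigenspace [Algebra ℝ 𝕂] {n : ℕ} (A : Matrix (Fin n) (Fin n) 𝕂) (s : ℝ) :
    Submodule 𝕂ᵐᵒᵖ (Fin n → 𝕂) where
  carrier := {v | A *ᵥ v = s • v}
  add_mem' := by
    intro v w hv hw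
    change A *ᵥ v = s • v at hv
    change A *ᵥ w = s • w at hw
    change A *ᵥ (v + w) = s • (v + w)
    rw [Matrix.mulVec_add, hv, hw, smul_add]
  zero_mem' := by simp
  smul_mem' := by
    intro c v hv
    change A *ᵥ v = s • v at hv
    change A *ᵥ (c • v) = s • (c • v)
    rw [Matrix.mulVec_smul, hv]
    ext i
    simp

/-- The orthogonal group `O(n, 𝕂) = {A | A A* = 1}`, as a subset of the space of matrices. -/
def orthogonalMatrices (n : ℕ) (𝕂 : Type*) [DivisionRing 𝕂] [StarRing 𝕂] :
    Set (Matrix (Fin n) (Fin n) 𝕂) :=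
  {A | A * Aᴴ = 1}

/-- The set `Σ(m)` of the orthogonal matrices `A` of size `m` with `A² = 1`. -/
def orthogonalInvolutions (m : ℕ) (𝕂 : Type*) [DivisionRing 𝕂] [StarRing 𝕂] :
    Set (Matrix (Fin m) (Fin m) 𝕂) :=
  {A | A ∈ orthogonalMatrices m 𝕂 ∧ A * A = 1}

/-- The height function `h_X(A) = re (Tr (X A))`. The real part `re : 𝕂 → ℝ` is passed
explicitly, since `𝕂` is to be replaced by the real, the complex or the quaternionic numbers. -/
def heightFunction (re : 𝕂 → ℝ) {n : ℕ} (X A : Matrix (Fin n) (Fin n) 𝕂) : ℝ :=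
  re (X * A).trace

end Algebra

/- The topology and smooth structure of the space of matrices come from the operator norm that
belongs to the supremum norm; all norms on this finite-dimensional real space are equivalent. -/
attribute [local instance] Matrix.linftyOpNormedRing Matrix.linftyOpNormedAlgebra

/-- The set of critical points of the height function `h_X` on the orthogonal group `O(n, 𝕂)`. -/
def heightCriticalSet {𝕂 : Type*} [NormedDivisionRing 𝕂] [StarRing 𝕂] [NormedAlgebra ℝ 𝕂]
    (re : 𝕂 → ℝ) {n : ℕ} (X : Matrix (Fin n) (Fin n) 𝕂) : Set (Matrix (Fin n) (Fin n) 𝕂) :=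
  {A | IsCriticalPointOn (heightFunction re X) (orthogonalMatrices n 𝕂) A}

/-! The tangent space of `O(n, 𝕂)` at `A` consists of the `W A` with `W` skew-Hermitian, and `(x, y)
↦ re Tr (x y*)` is an inner product for which Hermitian and skew-Hermitian matrices are orthogonal.
So `A` is critical exactly when `A X` is Hermitian, that is, `A X = X* A*`
(`isCriticalPointOn_iff`).

Near a critical `A₀` put `Z = (1 - B)(1 + B)⁻¹` with `B = A A₀*`. Then `A` is orthogonal and
critical iff `Z` is skew-Hermitian and anticommutes with the Hermitian matrix `A₀ X`. These
conditions are linear in `Z`, so the Cayley transform is a submanifold chart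
(`isEmbeddedSubmanifold_criticalSet`).

For the global shape, write `X = U D V*` with `D` real, diagonal and nonnegative, and substitute `A
= V B U*`. The equations become `B B* = 1` and `B D = D B*`. They force `B` to commute with `D²`, so
`B` is block diagonal along the distinct singular values. On the zero block the second equation is
void; on a block where `D = √t` it says `B = B*`, equivalently `B² = 1`. The columns of `V` for the
value `0` span `ker X`, and those of `U` for `√t` span the `t`-eigenspace of `X X*`, which gives the
block sizes.

The singular value decomposition is built by hand, uniformly for the three `𝕂`, using only real
polynomials and `x* x = ‖x‖²`. -/

section CayleyTransform

/-! ### Algebra of the Cayley transform -/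

variable {R : Type*} [Ring R]

/-- The Cayley transform `(1 - x) (1 + x)⁻¹`. -/
noncomputable def cayleyTransform (x : R) : R := (1 - x) * Ring.inverse (1 + x)

theorem cayleyTransform_mul_one_add {x : R} (hx : IsUnit (1 + x)) :
    cayleyTransform x * (1 + x) = 1 - x := by
  rw [cayleyTransform, mul_assoc, Ring.inverse_mul_cancel _ hx, mul_one]

theorem one_add_mul_cayleyTransform {x : R} (hx : IsUnit (1 + x)) :
    (1 + x) * cayleyTransform x = 1 - x := by
  have : Commute (1 + x) (1 - x) := by
    rw [commute_iff_eq]; noncomm_ring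
  rw [cayleyTransform, ← mul_assoc, this.eq, mul_assoc, Ring.mul_inverse_cancel _ hx, mul_one]

theorem IsUnit.one_add_star [StarRing R] {x : R} (hx : IsUnit (1 + x)) : IsUnit (1 + star x) := by
  simpa using hx.star

variable [Algebra ℝ R]

theorem one_add_cayleyTransform {x : R} (hx : IsUnit (1 + x)) :
    1 + cayleyTransform x = (2 : ℝ) • Ring.inverse (1 + x) := by
  have h : (1 + x) * Ring.inverse (1 + x) = 1 := Ring.mul_inverse_cancel _ hx
  have : 1 + cayleyTransform x
      = (1 + x) * Ring.inverse (1 + x) + (1 - x) * Ring.inverse (1 + x) := by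
    rw [h, cayleyTransform]
  rw [this, ← add_mul, two_smul]; noncomm_ring

theorem one_sub_cayleyTransform {x : R} (hx : IsUnit (1 + x)) :
    1 - cayleyTransform x = (2 : ℝ) • (x * Ring.inverse (1 + x)) := by
  have h : (1 + x) * Ring.inverse (1 + x) = 1 := Ring.mul_inverse_cancel _ hx
  have : 1 - cayleyTransform x
      = (1 + x) * Ring.inverse (1 + x) - (1 - x) * Ring.inverse (1 + x) := by
    rw [h, cayleyTransform]
  rw [this, ← sub_mul, two_smul]; noncomm_ring

theorem one_add_cayleyTransform_mul {x : R} (hx : IsUnit (1 + x)) :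
    (1 + cayleyTransform x) * ((2 : ℝ)⁻¹ • (1 + x)) = 1 := by
  rw [one_add_cayleyTransform hx, smul_mul_smul_comm, Ring.inverse_mul_cancel _ hx]
  norm_num

theorem mul_one_add_cayleyTransform {x : R} (hx : IsUnit (1 + x)) :
    ((2 : ℝ)⁻¹ • (1 + x)) * (1 + cayleyTransform x) = 1 := by
  rw [one_add_cayleyTransform hx, smul_mul_smul_comm, Ring.mul_inverse_cancel _ hx]
  norm_num

theorem isUnit_one_add_cayleyTransform {x : R} (hx : IsUnit (1 + x)) :
    IsUnit (1 + cayleyTransform x) :=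
  ⟨⟨_, _, one_add_cayleyTransform_mul hx, mul_one_add_cayleyTransform hx⟩, rfl⟩

theorem inverse_one_add_cayleyTransform {x : R} (hx : IsUnit (1 + x)) :
    Ring.inverse (1 + cayleyTransform x) = (2 : ℝ)⁻¹ • (1 + x) :=
  Ring.inverse_unit ⟨_, _, one_add_cayleyTransform_mul hx, mul_one_add_cayleyTransform hx⟩

theorem cayleyTransform_cayleyTransform {x : R} (hx : IsUnit (1 + x)) :
    cayleyTransform (cayleyTransform x) = x := by
  rw [cayleyTransform, inverse_one_add_cayleyTransform hx, one_sub_cayleyTransform hx,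
    smul_mul_smul_comm, mul_assoc, Ring.inverse_mul_cancel _ hx]
  norm_num

/-- Multiplying by the units `1 + x*` on the left and `1 + x` on the right clears the denominators;
what remains is twice `1 - x* x`. Dedekind finiteness exchanges `x* x = 1` and `x x* = 1`. -/
theorem star_cayleyTransform_eq_neg_iff [StarRing R] [IsDedekindFiniteMonoid R] {x : R}
    (hx : IsUnit (1 + x)) :
    star (cayleyTransform x) = -cayleyTransform x ↔ x * star x = 1 := by
  have hx' := hx.one_add_star
  have e1 : (1 + star x) * star (cayleyTransform x) = 1 - star x := by
    simpa using congrArg star (cayleyTransform_mul_one_add hx)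
  have e2 := cayleyTransform_mul_one_add hx
  rw [← hx'.mul_right_inj, ← hx.mul_left_inj, e1, mul_assoc, neg_mul, e2]
  have : (1 - star x) * (1 + x) - (1 + star x) * (-(1 - x)) = (2 : ℝ) • (1 - star x * x) := by
    rw [two_smul]; noncomm_ring
  rw [← sub_eq_zero, this, smul_eq_zero, sub_eq_zero, mul_eq_one_comm, eq_comm (a := (1 : R))]
  simp

/-- Multiplying by `1 + x` on both sides turns the anticommutator into `2 (h - x h x)`. This
linearizes the criticality equation in the Cayley chart. -/
theorem cayleyTransform_mul_add_eq_zero_iff [IsDedekindFiniteMonoid R] {x h : R}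
    (hx : IsUnit (1 + x)) :
    cayleyTransform x * h + h * cayleyTransform x = 0 ↔ x * h * x = h := by
  have e1 := one_add_mul_cayleyTransform hx
  have e2 := cayleyTransform_mul_one_add hx
  rw [← hx.mul_right_inj, ← hx.mul_left_inj, mul_zero, zero_mul]
  have : (1 + x) * (cayleyTransform x * h + h * cayleyTransform x) * (1 + x)
      = (1 + x) * cayleyTransform x * h * (1 + x)
        + (1 + x) * h * (cayleyTransform x * (1 + x)) := by noncomm_ring
  rw [this, e1, e2]
  have : (1 - x) * h * (1 + x) + (1 + x) * h * (1 - x) = (2 : ℝ) • (h - x * h * x) := by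
    rw [two_smul]; noncomm_ring
  rw [this, smul_eq_zero, sub_eq_zero, eq_comm (a := h)]
  simp

end CayleyTransform

/-! ### Smoothness of the exponential and of the Cayley transform -/

section NormedAlgebra

variable {R : Type*} [NormedRing R] [NormedAlgebra ℝ R] [FiniteDimensional ℝ R]

theorem contDiff_exp_smul (W : R) : ContDiff ℝ ∞ fun s : ℝ => NormedSpace.exp (s • W) := by
  have : CompleteSpace R := FiniteDimensional.complete ℝ R
  have h : ContDiff ℝ ∞ (NormedSpace.exp : R → R) :=
    contDiff_iff_contDiffAt.2 fun x => (NormedSpace.exp_analytic (𝕂 := ℝ) x).contDiffAt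
  exact h.comp (contDiff_id.smul contDiff_const)

theorem contDiffOn_cayleyTransform :
    ContDiffOn ℝ ∞ (cayleyTransform : R → R) {x | IsUnit (1 + x)} := by
  have : CompleteSpace R := FiniteDimensional.complete ℝ R
  rintro x ⟨u, hu⟩
  refine ContDiffAt.contDiffWithinAt ?_
  have h : ContDiffAt ℝ ∞ Ring.inverse (1 + x) := hu ▸ contDiffAt_ringInverse ℝ u
  exact (contDiffAt_const.sub contDiffAt_id).mul
    (h.comp x (contDiffAt_const.add contDiffAt_id))

theorem isOpen_isUnit_one_add : IsOpen {x : R | IsUnit (1 + x)} := by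
  have : CompleteSpace R := FiniteDimensional.complete ℝ R
  exact Units.isOpen.preimage (continuous_const.add continuous_id)

end NormedAlgebra

/-! ### Critical points and charts in a finite-dimensional star algebra -/

section StarAlgebra

variable {R : Type*} [NormedRing R] [NormedAlgebra ℝ R] [FiniteDimensional ℝ R] [StarRing R]
  [StarModule ℝ R]

/-- The star operation of a finite-dimensional star algebra, as a continuous linear map. -/
noncomputable def starContinuousLinearMap (R : Type*) [NormedRing R] [NormedAlgebra ℝ R]
    [FiniteDimensional ℝ R] [StarRing R] [StarModule ℝ R] : R →L[ℝ] R :=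
  LinearMap.toContinuousLinearMap
    { toFun := star
      map_add' := star_add
      map_smul' := fun r x => by simp }

theorem continuousStar_of_finiteDimensional : ContinuousStar R :=
  ⟨(starContinuousLinearMap R).continuous⟩

theorem exp_mul_star_exp_of_skew {W : R} (hW : star W = -W) (s : ℝ) :
    NormedSpace.exp (s • W) * star (NormedSpace.exp (s • W)) = 1 := by
  have : CompleteSpace R := FiniteDimensional.complete ℝ R
  have : ContinuousStar R := continuousStar_of_finiteDimensional
  let : NormedAlgebra ℚ R := NormedAlgebra.restrictScalars ℚ ℝ R
  rw [NormedSpace.star_exp, star_smul, hW, smul_neg, star_trivial,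
    ← NormedSpace.exp_add_of_commute (Commute.neg_right (Commute.refl _))]
  simp

/-- Here `l` plays the real part of the trace. The derivative in the direction `W A` is `l (A X W)`;
it vanishes for all skew `W` iff `A X` is self-adjoint, and the curves `exp (s W) A` realize these
directions. -/
theorem isCriticalPointOn_iff [IsDedekindFiniteMonoid R] (l : R →ₗ[ℝ] ℝ)
    (hcomm : ∀ x y, l (x * y) = l (y * x)) (hstar : ∀ x, l (star x) = l x)
    (hpos : ∀ x, l (x * star x) = 0 → x = 0) (X A : R) :
    IsCriticalPointOn (fun B => l (X * B)) {B | B * star B = 1} A ↔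
      A * star A = 1 ∧ A * X = star X * star A := by
  have : CompleteSpace R := FiniteDimensional.complete ℝ R
  let L : R →L[ℝ] ℝ := LinearMap.toContinuousLinearMap l
  have hderiv : ∀ (γ : ℝ → R) (D : R), HasDerivAt γ D 0 →
      HasDerivAt (fun s => l (X * γ s)) (l (X * D)) 0 := fun γ D h =>
    L.hasFDerivAt.comp_hasDerivAt (0 : ℝ) (h.const_mul X)
  constructor
  · rintro ⟨hA, hcrit⟩
    have hA : A * star A = 1 := hA
    refine ⟨hA, ?_⟩
    -- Up to a factor, `W` is the skew part of `A X`. Along `exp (s W) A` the derivative is `l (A X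
    -- W)`, which is half of `l (W W*)`, so positivity gives `W = 0`.
    set W : R := star (A * X) - A * X with hWdef
    have hW : star W = -W := by simp [hWdef]
    have h1 : HasDerivAt (fun s : ℝ => NormedSpace.exp (s • W) * A) (W * A) 0 := by
      have := (hasDerivAt_exp_smul_const (𝕂 := ℝ) W (0 : ℝ)).mul_const A
      simpa using this
    have h2 := hcrit (fun s => NormedSpace.exp (s • W) * A)
      ((contDiff_exp_smul W).mul contDiff_const) (fun s => by
        change _ * _ = (1 : R)
        rw [star_mul, mul_assoc, ← mul_assoc A, hA, one_mul, exp_mul_star_exp_of_skew hW])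
      (by simp)
    have h3 : l (X * (W * A)) = 0 := (hderiv _ _ h1).unique h2
    have h4 : l (A * X * W) = 0 := by
      rw [mul_assoc, hcomm, mul_assoc] ; exact h3
    have h5 : l (W * star W) = 0 := by
      have e1 : W * star W = A * X * W - star (A * X) * W := by
        rw [hW, hWdef]; noncomm_ring
      have e2 : l (star (A * X) * W) = - l (A * X * W) := by
        rw [← hstar, star_mul, hW, star_star, hcomm, mul_neg, map_neg]
      rw [e1, map_sub, e2, h4]; simp
    have h6 := sub_eq_zero.1 (hpos W h5)
    rw [← h6, star_mul]
  · rintro ⟨hA, hX⟩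
    refine ⟨hA, fun γ hγ hmem h0 => ?_⟩
    have hd : HasDerivAt γ (deriv γ 0) 0 :=
      ((hγ.differentiable (by simp)) 0).hasDerivAt
    set D := deriv γ 0
    have hs : HasDerivAt (fun s => star (γ s)) (star D) 0 :=
      (starContinuousLinearMap R).hasFDerivAt.comp_hasDerivAt (0 : ℝ) hd
    have h1 := hd.mul hs
    have h2 : HasDerivAt (fun s => γ s * star (γ s)) 0 0 := by
      have : (fun s => γ s * star (γ s)) = fun _ => (1 : R) := funext hmem
      rw [this]; exact hasDerivAt_const _ _
    have h3 : D * star A + A * star D = 0 := by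
      have := h1.unique h2
      rwa [h0] at this
    have hA' : star A * A = 1 := mul_eq_one_comm.1 hA
    have hsk : star (D * star A) = -(D * star A) := by
      rw [star_mul, star_star]; exact eq_neg_of_add_eq_zero_right h3
    have h4 : l (X * D) = l (A * X * (D * star A)) := by
      rw [hcomm (A * X), ← mul_assoc, mul_assoc D, hA', mul_one, hcomm]
    -- A self-adjoint and a skew element are orthogonal: applying `star` changes the sign of the
    -- pairing.
    have h5 : l (A * X * (D * star A)) = 0 := by
      have : l (A * X * (D * star A)) = - l (A * X * (D * star A)) := by
        conv_lhs => rw [← hstar, star_mul, hsk, star_mul, ← hX, hcomm, mul_neg, map_neg]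
      linarith
    have h6 := hderiv γ D hd
    rwa [h4, h5] at h6

theorem isEmbeddedSubmanifold_criticalSet [IsDedekindFiniteMonoid R] (X : R) :
    IsEmbeddedSubmanifold {A : R | A * star A = 1 ∧ A * X = star X * star A} := by
  rintro A₀ ⟨hA, hX⟩
  have hA' : star A₀ * A₀ = 1 := mul_eq_one_comm.1 hA
  have hcont : ContDiff ℝ ∞ fun A : R => A * star A₀ := contDiff_id.mul contDiff_const
  have hcont' : ContDiff ℝ ∞ fun A : R => A * A₀ := contDiff_id.mul contDiff_const
  have hc : ContDiffOn ℝ ∞ (fun A : R => cayleyTransform (A * star A₀))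
      {A | IsUnit (1 + A * star A₀)} :=
    contDiffOn_cayleyTransform.comp hcont.contDiffOn fun _ h => h
  have hc' : ContDiffOn ℝ ∞ (fun Z : R => cayleyTransform Z * A₀) {Z | IsUnit (1 + Z)} :=
    hcont'.comp_contDiffOn contDiffOn_cayleyTransform
  let φ : OpenPartialHomeomorph R R :=
    { toFun := fun A => cayleyTransform (A * star A₀)
      invFun := fun Z => cayleyTransform Z * A₀
      source := {A | IsUnit (1 + A * star A₀)}
      target := {Z | IsUnit (1 + Z)}
      map_source' := fun A h => isUnit_one_add_cayleyTransform h
      map_target' := fun Z h => by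
        change IsUnit (1 + cayleyTransform Z * A₀ * star A₀)
        rw [mul_assoc, hA, mul_one]
        exact isUnit_one_add_cayleyTransform h
      left_inv' := fun A h => by
        rw [cayleyTransform_cayleyTransform h, mul_assoc, hA', mul_one]
      right_inv' := fun Z h => by
        rw [mul_assoc, hA, mul_one, cayleyTransform_cayleyTransform h]
      open_source := isOpen_isUnit_one_add.preimage hcont.continuous
      open_target := isOpen_isUnit_one_add
      continuousOn_toFun := hc.continuousOn
      continuousOn_invFun := hc'.continuousOn }
  -- The model subspace depends on `A₀`, so its dimension may vary between components.
  let V : Submodule ℝ R :=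
    { carrier := {Z | star Z = -Z ∧ Z * (A₀ * X) + (A₀ * X) * Z = 0}
      zero_mem' := by simp
      add_mem' := by
        rintro a b ⟨ha, ha'⟩ ⟨hb, hb'⟩
        refine ⟨by rw [star_add, ha, hb, neg_add], ?_⟩
        rw [add_mul, mul_add, add_add_add_comm, ha', hb', add_zero]
      smul_mem' := by
        rintro c a ⟨ha, ha'⟩
        refine ⟨by rw [star_smul, ha, star_trivial, smul_neg], ?_⟩
        rw [smul_mul_assoc, mul_smul_comm, ← smul_add, ha', smul_zero] }
  refine ⟨φ, V, ?_, hc, hc', ?_⟩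
  · change IsUnit (1 + A₀ * star A₀)
    rw [hA, one_add_one_eq_two]
    have h2 := (IsUnit.mk0 (2 : ℝ) two_ne_zero).map (algebraMap ℝ R)
    rwa [map_ofNat] at h2
  have key : ∀ A : R, IsUnit (1 + A * star A₀) →
      ((A * star A = 1 ∧ A * X = star X * star A) ↔ cayleyTransform (A * star A₀) ∈ V) := by
    intro A h
    change _ ↔ (star _ = _ ∧ _ = _)
    rw [star_cayleyTransform_eq_neg_iff h, cayleyTransform_mul_add_eq_zero_iff h]
    have e : A * star A₀ * star (A * star A₀) = A * star A := by
      rw [star_mul, star_star, mul_assoc, ← mul_assoc (star A₀), hA', one_mul]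
    -- With `x = A A₀*` and `h = A₀ X = X* A₀*`, the equation `x h x = h` reads `A X A = X*`, which
    -- for orthogonal `A` is `A X = X* A*`.
    have e' : A * star A₀ * (A₀ * X) * (A * star A₀) = A * X * A * star A₀ := by
      rw [mul_assoc A, ← mul_assoc (star A₀), hA', one_mul]; noncomm_ring
    rw [e, e', hX]
    refine and_congr_right fun hAA => ?_
    have hAA' : star A * A = 1 := mul_eq_one_comm.1 hAA
    constructor
    · intro h; rw [h, mul_assoc (star X), hAA', mul_one]
    · intro h
      have h1 := congrArg (fun z => z * A₀ * star A) h
      simpa [mul_assoc, hA', hAA, ← mul_assoc (star A₀)] using h1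
  ext Z
  constructor
  · rintro ⟨A, ⟨hAS, hAs⟩, rfl⟩
    exact ⟨(key A hAs).1 hAS, φ.map_source hAs⟩
  · rintro ⟨hZ, hZt⟩
    have hs := φ.map_target hZt
    refine ⟨φ.symm Z, ⟨(key _ hs).2 ?_, hs⟩, φ.right_inv hZt⟩
    have : cayleyTransform (φ.symm Z * star A₀) = Z := φ.right_inv hZt
    rw [this]; exact hZ

end StarAlgebra

/-- A star structure on a normed real division algebra with `x* x = ‖x‖²`, as for the real, the
complex and the quaternionic numbers. -/
class StarMulSelfEqNormSq (𝕂 : Type*) [NormedDivisionRing 𝕂] [StarRing 𝕂] [NormedAlgebra ℝ 𝕂] :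
    Prop where
  star_mul_self_eq : ∀ x : 𝕂, star x * x = algebraMap ℝ 𝕂 (‖x‖ ^ 2)

/-! ### Singular value decomposition over the three number systems -/

section SingularValues

variable {𝕂 : Type*} [NormedDivisionRing 𝕂] [StarRing 𝕂] [NormedAlgebra ℝ 𝕂]
  [StarMulSelfEqNormSq 𝕂]

open StarMulSelfEqNormSq

theorem norm_star_eq_norm (x : 𝕂) : ‖star x‖ = ‖x‖ := by
  rcases eq_or_ne x 0 with rfl | hx
  · simp
  · have h := congrArg norm (star_mul_self_eq x)
    rw [norm_mul, norm_algebraMap', Real.norm_of_nonneg (by positivity), sq] at h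
    exact mul_right_cancel₀ (norm_ne_zero_iff.2 hx) h

theorem mul_star_self_eq (x : 𝕂) : x * star x = algebraMap ℝ 𝕂 (‖x‖ ^ 2) := by
  simpa [norm_star_eq_norm] using star_mul_self_eq (star x)

variable {m n : Type*}

theorem conjTranspose_mul_self_apply_self [Fintype m] (M : Matrix m n 𝕂) (j : n) :
    (Mᴴ * M) j j = algebraMap ℝ 𝕂 (∑ i, ‖M i j‖ ^ 2) := by
  simp [Matrix.mul_apply, star_mul_self_eq, map_sum]

theorem mul_conjTranspose_self_apply_self [Fintype n] (M : Matrix m n 𝕂) (i : m) :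
    (M * Mᴴ) i i = algebraMap ℝ 𝕂 (∑ j, ‖M i j‖ ^ 2) := by
  simp [Matrix.mul_apply, mul_star_self_eq, map_sum]

variable [Fintype m]

/-- The diagonal entries of a Gram matrix are real sums of squared norms, so positivity can be used
entrywise without an order on `𝕂`. -/
theorem eq_zero_of_gram_add_smul_gram_eq_zero {M N : Matrix m n 𝕂} {r : ℝ} (hr : 0 < r)
    (h : Mᴴ * M + r • (Nᴴ * N) = 0) : N = 0 := by
  ext i j
  have h1 := congrFun (congrFun h j) j
  rw [Matrix.add_apply, Matrix.smul_apply, conjTranspose_mul_self_apply_self,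
    conjTranspose_mul_self_apply_self, Algebra.smul_def, ← map_mul, ← map_add, Matrix.zero_apply,
    map_eq_zero] at h1
  have hM : 0 ≤ ∑ i, ‖M i j‖ ^ 2 := Finset.sum_nonneg fun _ _ => by positivity
  have hN : ‖N i j‖ ^ 2 ≤ ∑ i, ‖N i j‖ ^ 2 :=
    Finset.single_le_sum (f := fun i => ‖N i j‖ ^ 2) (fun _ _ => by positivity)
      (Finset.mem_univ i)
  have h2 : ‖N i j‖ ^ 2 ≤ 0 := by
    have : r * ‖N i j‖ ^ 2 ≤ r * ∑ i, ‖N i j‖ ^ 2 := mul_le_mul_of_nonneg_left hN hr.le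
    exact le_of_mul_le_mul_left (by linarith) hr
  simpa using pow_eq_zero_iff (two_ne_zero) |>.1 (le_antisymm h2 (by positivity))

theorem eq_zero_of_gram_eq_zero {M : Matrix m n 𝕂} (h : Mᴴ * M = 0) : M = 0 :=
  eq_zero_of_gram_add_smul_gram_eq_zero (M := (0 : Matrix m n 𝕂)) one_pos (by simpa using h)

section

variable [Fintype n] [DecidableEq n] [StarModule ℝ 𝕂]

open Polynomial in
-- Real factors of `p` are peeled off one at a time. A factor `X - c` with `c ≠ 0` is removable by
-- `hno`, a factor `X` because `H² K = 0` implies `H K = 0`, and an irreducible quadratic because it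
-- is a sum of squares at the Hermitian `H`.
theorem mul_eq_zero_of_aeval_mul_eq_zero {H : Matrix n n 𝕂} (hH : Hᴴ = H)
    (hno : ∀ c : ℝ, c ≠ 0 → ∀ K : Matrix n n 𝕂, H * K = c • K → K = 0) (d : ℕ) :
    ∀ p : ℝ[X], p.natDegree ≤ d → p ≠ 0 → ∀ K : Matrix n n 𝕂, aeval H p * K = 0 → H * K = 0 := by
  induction d with
  | zero =>
    intro p hd hp K hK
    obtain ⟨c, rfl⟩ := natDegree_eq_zero.1 (Nat.le_zero.1 hd)
    have hc : c ≠ 0 := by simpa using hp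
    rw [aeval_C, ← Algebra.smul_def, smul_eq_zero] at hK
    rw [hK.resolve_left hc, mul_zero]
  | succ d ih =>
    intro p hd hp K hK
    by_cases h0 : p.natDegree = 0
    · exact ih p (by omega) hp K hK
    obtain ⟨z, hz⟩ := IsAlgClosed.exists_aeval_eq_zero ℂ p
      (fun h => h0 (natDegree_eq_of_degree_eq_some h))
    by_cases him : z.im = 0
    · have hz' : p.IsRoot z.re := by
        have hzz : z = algebraMap ℝ ℂ z.re := Complex.ext rfl (by simpa using him)
        rw [hzz, aeval_algebraMap_apply] at hz
        simpa using hz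
      obtain ⟨q, rfl⟩ := dvd_iff_isRoot.2 hz'
      have hq : q ≠ 0 := right_ne_zero_of_mul hp
      have hdq : q.natDegree ≤ d := by
        rw [natDegree_mul (X_sub_C_ne_zero _) hq, natDegree_X_sub_C] at hd
        omega
      rw [map_mul, map_sub, aeval_X, aeval_C, mul_assoc, sub_mul, ← Algebra.smul_def,
        sub_eq_zero] at hK
      by_cases hre : z.re = 0
      · rw [hre, zero_smul] at hK
        have hcomm : aeval H q * H = H * aeval H q := by
          have := congrArg (aeval H) (mul_comm q X)
          simpa using this
        have h1 := ih q hdq hq (H * K) (by rw [← mul_assoc, hcomm, mul_assoc, hK])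
        refine eq_zero_of_gram_eq_zero ?_
        rw [Matrix.conjTranspose_mul, hH, mul_assoc, h1, mul_zero]
      · exact ih q hdq hq K (hno _ hre _ hK)
    · obtain ⟨q, rfl⟩ := quadratic_dvd_of_aeval_eq_zero_im_ne_zero p hz him
      have hq : q ≠ 0 := right_ne_zero_of_mul hp
      have hqz := left_ne_zero_of_mul hp
      have hdeg : (X ^ 2 - C (2 * z.re) * X + C (‖z‖ ^ 2)).natDegree = 2 := by
        compute_degree!
      have hdq : q.natDegree ≤ d := by
        rw [natDegree_mul hqz hq, hdeg] at hd
        omega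
      refine ih q hdq hq K ?_
      rw [map_mul, mul_assoc] at hK
      generalize aeval H q * K = L at hK ⊢
      have hK' : H * (H * L) - (2 * z.re) • (H * L) + (‖z‖ ^ 2) • L = 0 := by
        simpa [add_mul, sub_mul, mul_assoc, sq H, Algebra.smul_def] using hK
      have hn : ‖z‖ ^ 2 = z.re ^ 2 + z.im ^ 2 := by
        rw [← Complex.normSq_eq_norm_sq, Complex.normSq_apply]; ring
      -- Completing the square: `H² - 2 a H + |z|² = (H - a)² + b²` for `z = a + b i`, with `b ≠ 0`.
      refine eq_zero_of_gram_add_smul_gram_eq_zero (M := H * L - z.re • L) (r := z.im ^ 2)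
        (by positivity) ?_
      have : (H * L - z.re • L)ᴴ * (H * L - z.re • L) + z.im ^ 2 • (Lᴴ * L)
          = Lᴴ * (H * (H * L) - (2 * z.re) • (H * L) + (‖z‖ ^ 2) • L) := by
        rw [hn, Matrix.conjTranspose_sub, Matrix.conjTranspose_mul, hH, Matrix.conjTranspose_smul,
          star_trivial]
        simp only [sub_mul, mul_sub, mul_add, smul_mul_assoc, mul_smul_comm, mul_assoc]
        module
      rw [this, hK', mul_zero]

/-- Otherwise the previous lemma, applied to the minimal polynomial over `ℝ` and `K = 1`, would give
`H = 0`. Real coefficients are central, so noncommutativity of `𝕂` does no harm. -/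
theorem exists_eigenmatrix_of_conjTranspose_eq [FiniteDimensional ℝ 𝕂] {H : Matrix n n 𝕂}
    (hH : Hᴴ = H) (h0 : H ≠ 0) :
    ∃ c : ℝ, c ≠ 0 ∧ ∃ K : Matrix n n 𝕂, K ≠ 0 ∧ H * K = c • K := by
  by_contra! hno
  have hint : IsIntegral ℝ H := IsIntegral.of_finite ℝ H
  have := mul_eq_zero_of_aeval_mul_eq_zero hH
    (fun c hc K hK => by_contra fun h => hno c hc K h hK) _ (minpoly ℝ H) le_rfl
    (minpoly.ne_zero hint) 1 (by simp)
  exact h0 (by simpa using this)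

theorem exists_mul_gram_eq_one {M : Matrix m n 𝕂} (hM : M ≠ 0) :
    ∃ w : Matrix n (Fin 1) 𝕂, (M * w)ᴴ * (M * w) = 1 := by
  obtain ⟨i, j, hij⟩ : ∃ i j, M i j ≠ 0 := by
    by_contra! h
    exact hM (Matrix.ext h)
  set r : ℝ := ∑ i, ‖M i j‖ ^ 2 with hr
  have hrpos : 0 < r := Finset.sum_pos' (fun _ _ => by positivity)
    ⟨i, Finset.mem_univ i, by have := norm_pos_iff.2 hij; positivity⟩
  refine ⟨(√r)⁻¹ • Matrix.single j 0 1, ?_⟩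
  have h1 : M * Matrix.single j (0 : Fin 1) (1 : 𝕂) = Matrix.of fun i _ => M i j := by
    ext a b
    obtain rfl : b = 0 := Subsingleton.elim _ _
    simp
  rw [Matrix.mul_smul, h1, Matrix.conjTranspose_smul, Matrix.smul_mul, Matrix.mul_smul,
    star_trivial, smul_smul, ← mul_inv, Real.mul_self_sqrt hrpos.le]
  ext a b
  obtain rfl : b = 0 := Subsingleton.elim _ _
  obtain rfl : a = 0 := Subsingleton.elim _ _
  rw [Matrix.smul_apply, conjTranspose_mul_self_apply_self, Algebra.smul_def, ← map_mul]
  simp only [Matrix.of_apply, ← hr, inv_mul_cancel₀ hrpos.ne', map_one, Matrix.one_apply_eq]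

/-- `E` and `F` are orthogonal projections intertwined by `X`. If `X E = 0`, any unit vectors in
their ranges serve with `s = 0`; otherwise `v` is a unit eigenvector of `(X E)* (X E)` with
eigenvalue `c ≠ 0`, and `u = X v / √c`. -/
theorem exists_singular_pair [FiniteDimensional ℝ 𝕂] {X E F : Matrix n n 𝕂} (hE : Eᴴ = E)
    (hEE : E * E = E) (hE0 : E ≠ 0) (hF : Fᴴ = F) (hFF : F * F = F) (hF0 : F ≠ 0)
    (hX : X * E = F * X) :
    ∃ (v u : Matrix n (Fin 1) 𝕂) (s : ℝ), 0 ≤ s ∧ E * v = v ∧ F * u = u ∧ vᴴ * v = 1 ∧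
      uᴴ * u = 1 ∧ X * v = s • u ∧ Xᴴ * u = s • v := by
  have hX' : Xᴴ * F = E * Xᴴ := by
    have := congrArg Matrix.conjTranspose hX
    rw [Matrix.conjTranspose_mul, Matrix.conjTranspose_mul, hE, hF] at this
    exact this.symm
  by_cases hY : X * E = 0
  · obtain ⟨w, hw⟩ := exists_mul_gram_eq_one hE0
    obtain ⟨w', hw'⟩ := exists_mul_gram_eq_one hF0
    refine ⟨E * w, F * w', 0, le_rfl, ?_, ?_, hw, hw', ?_, ?_⟩
    · rw [← Matrix.mul_assoc, hEE]
    · rw [← Matrix.mul_assoc, hFF]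
    · rw [← Matrix.mul_assoc, hY, Matrix.zero_mul, zero_smul]
    · have : Xᴴ * F = 0 := by
        rw [hX', ← hE, ← Matrix.conjTranspose_mul, hY, Matrix.conjTranspose_zero]
      rw [← Matrix.mul_assoc, this, Matrix.zero_mul, zero_smul]
  · have hH0 : (X * E)ᴴ * (X * E) ≠ 0 := fun h => hY (eq_zero_of_gram_eq_zero h)
    set H := (X * E)ᴴ * (X * E) with hHdef
    obtain ⟨c, hc, K, hK, hHK⟩ := exists_eigenmatrix_of_conjTranspose_eq (H := H)
      (by rw [hHdef, Matrix.conjTranspose_mul, Matrix.conjTranspose_conjTranspose]) hH0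
    obtain ⟨w, hw⟩ := exists_mul_gram_eq_one hK
    have hHv : H * (K * w) = c • (K * w) := by rw [← Matrix.mul_assoc, hHK, Matrix.smul_mul]
    generalize K * w = v at hw hHv
    have hgram : (X * E * v)ᴴ * (X * E * v) = c • (1 : Matrix (Fin 1) (Fin 1) 𝕂) := by
      rw [Matrix.conjTranspose_mul, Matrix.mul_assoc, ← Matrix.mul_assoc (X * E)ᴴ, ← hHdef, hHv,
        Matrix.mul_smul, hw]
    have hcpos : 0 < c := by
      have h1 := congrFun (congrFun hgram 0) 0
      rw [conjTranspose_mul_self_apply_self, Matrix.smul_apply, Matrix.one_apply_eq,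
        ← Algebra.algebraMap_eq_smul_one] at h1
      have h2 := (algebraMap ℝ 𝕂).injective h1
      exact lt_of_le_of_ne (h2 ▸ Finset.sum_nonneg fun _ _ => by positivity) hc.symm
    have hEH : E * H = H := by
      rw [hHdef, Matrix.conjTranspose_mul, hE, ← Matrix.mul_assoc, ← Matrix.mul_assoc E, hEE]
    -- Since `E H = H` and `c ≠ 0`, the eigenvector `v = c⁻¹ H v` lies in the range of `E`.
    have hEv : E * v = v := by
      have h1 : E * (c • v) = c • v := by rw [← hHv, ← Matrix.mul_assoc, hEH]
      rw [Matrix.mul_smul] at h1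
      exact smul_right_injective _ hc h1
    have hXEv : X * E * v = X * v := by rw [Matrix.mul_assoc, hEv]
    rw [hXEv] at hgram
    have hs : 0 < √c := Real.sqrt_pos.2 hcpos
    have hXXv : Xᴴ * (X * v) = c • v := by
      rw [← hHv, hHdef, Matrix.mul_assoc, hXEv, Matrix.conjTranspose_mul, hE, ← hX',
        Matrix.mul_assoc, ← Matrix.mul_assoc F, ← hX, hXEv]
    refine ⟨v, (√c)⁻¹ • (X * v), √c, hs.le, hEv, ?_, hw, ?_, ?_, ?_⟩
    · rw [Matrix.mul_smul, ← Matrix.mul_assoc, ← hX, hXEv]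
    · rw [Matrix.conjTranspose_smul, Matrix.smul_mul, Matrix.mul_smul, hgram, star_trivial,
        smul_smul, smul_smul, ← mul_inv, Real.mul_self_sqrt hcpos.le, inv_mul_cancel₀ hc,
        one_smul]
    · rw [smul_smul, mul_inv_cancel₀ hs.ne', one_smul]
    · rw [Matrix.mul_smul, hXXv, smul_smul]
      congr 1
      rw [inv_mul_eq_iff_eq_mul₀ hs.ne', Real.mul_self_sqrt hcpos.le]

end

/-- The sum of all `‖V i j‖²` counts the columns when summed by columns and the rows when summed by
rows. -/
theorem card_eq_of_conjTranspose_mul_eq_one [DecidableEq m] [Fintype n]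
    [DecidableEq n] {V : Matrix m n 𝕂}
    (h : Vᴴ * V = 1) (h' : V * Vᴴ = 1) : Fintype.card m = Fintype.card n := by
  have h1 : ∀ j, ∑ i, ‖V i j‖ ^ 2 = 1 := fun j => (algebraMap ℝ 𝕂).injective <| by
    rw [← conjTranspose_mul_self_apply_self, h, Matrix.one_apply_eq, map_one]
  have h2 : ∀ i, ∑ j, ‖V i j‖ ^ 2 = 1 := fun i => (algebraMap ℝ 𝕂).injective <| by
    rw [← mul_conjTranspose_self_apply_self, h', Matrix.one_apply_eq, map_one]
  have h3 : ∑ i, ∑ j, ‖V i j‖ ^ 2 = ∑ j, ∑ i, ‖V i j‖ ^ 2 := Finset.sum_comm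
  simp only [h1, h2, Finset.sum_const, Finset.card_univ, nsmul_eq_mul, mul_one] at h3
  exact_mod_cast h3

/-- Induction on the number of columns: a new singular pair is taken in the orthogonal complements
of the old ones. The equation for `X*` is carried along because it makes `X` intertwine the
complementary projections. -/
theorem exists_partial_singular_value_decomposition [StarModule ℝ 𝕂] [FiniteDimensional ℝ 𝕂]
    {n : ℕ} (X : Matrix (Fin n) (Fin n) 𝕂) (k : ℕ) (hk : k ≤ n) :
    ∃ (V U : Matrix (Fin n) (Fin k) 𝕂) (s : Fin k → ℝ), (∀ j, 0 ≤ s j) ∧ Vᴴ * V = 1 ∧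
      Uᴴ * U = 1 ∧ X * V = U * Matrix.diagonal (fun j => algebraMap ℝ 𝕂 (s j)) ∧
      Xᴴ * U = V * Matrix.diagonal (fun j => algebraMap ℝ 𝕂 (s j)) := by
  induction k with
  | zero => exact ⟨0, 0, 0, fun j => j.elim0, by ext i; exact i.elim0, by ext i; exact i.elim0,
      by ext i j; exact j.elim0, by ext i j; exact j.elim0⟩
  | succ k ih =>
    obtain ⟨V, U, s, hs, hV, hU, hXV, hXU⟩ := ih (by omega)
    have proj : ∀ W : Matrix (Fin n) (Fin k) 𝕂, Wᴴ * W = 1 →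
        (1 - W * Wᴴ)ᴴ = 1 - W * Wᴴ ∧ (1 - W * Wᴴ) * (1 - W * Wᴴ) = 1 - W * Wᴴ ∧
          1 - W * Wᴴ ≠ 0 ∧ ∀ w : Matrix (Fin n) (Fin 1) 𝕂, (1 - W * Wᴴ) * w = w →
            Wᴴ * w = 0 := by
      intro W hW
      have h1 : Wᴴ * (1 - W * Wᴴ) = 0 := by
        rw [Matrix.mul_sub, Matrix.mul_one, ← Matrix.mul_assoc, hW, Matrix.one_mul, sub_self]
      refine ⟨by simp, ?_, ?_, ?_⟩
      · rw [Matrix.sub_mul, Matrix.one_mul, Matrix.mul_assoc, h1, Matrix.mul_zero, sub_zero]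
      -- A vanishing complement would make `W` unitary and force `n = k`.
      · intro h
        have := card_eq_of_conjTranspose_mul_eq_one hW (sub_eq_zero.1 h).symm
        simp only [Fintype.card_fin] at this
        omega
      · intro w hw
        rw [← hw, ← Matrix.mul_assoc, h1, Matrix.zero_mul]
    obtain ⟨hE, hEE, hE0, hEv⟩ := proj V hV
    obtain ⟨hF, hFF, hF0, hFu⟩ := proj U hU
    have hD : (Matrix.diagonal fun j => algebraMap ℝ 𝕂 (s j))ᴴ
        = Matrix.diagonal fun j => algebraMap ℝ 𝕂 (s j) := by
      rw [Matrix.diagonal_conjTranspose]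
      congr 1; ext j
      simp [← algebraMap_star_comm]
    have hcomm : X * (1 - V * Vᴴ) = (1 - U * Uᴴ) * X := by
      have h1 := congrArg Matrix.conjTranspose hXU
      rw [Matrix.conjTranspose_mul, Matrix.conjTranspose_mul, hD,
        Matrix.conjTranspose_conjTranspose] at h1
      rw [Matrix.mul_sub, Matrix.sub_mul, Matrix.mul_one, Matrix.one_mul, ← Matrix.mul_assoc, hXV,
        Matrix.mul_assoc U Uᴴ, h1, Matrix.mul_assoc]
    obtain ⟨v, u, r, hr, hv, hu, hvv, huu, hXv, hXu⟩ :=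
      exists_singular_pair hE hEE hE0 hF hFF hF0 hcomm
    have hVv := hEv v hv
    have hUu := hFu u hu
    let e : Fin (k + 1) ≃ Fin k ⊕ Fin 1 := finSumFinEquiv.symm
    have gram : ∀ (W : Matrix (Fin n) (Fin k) 𝕂) (w : Matrix (Fin n) (Fin 1) 𝕂), Wᴴ * W = 1 →
        wᴴ * w = 1 → Wᴴ * w = 0 → ((Matrix.fromCols W w).submatrix id e)ᴴ *
          (Matrix.fromCols W w).submatrix id e = 1 := by
      intro W w hW hw hWw
      have hwW : wᴴ * W = 0 := by
        have := congrArg Matrix.conjTranspose hWw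
        simpa using this
      rw [Matrix.conjTranspose_submatrix, Matrix.submatrix_mul _ _ e id e Function.bijective_id |>.symm,
        Matrix.conjTranspose_fromCols_eq_fromRows_conjTranspose, Matrix.fromRows_mul_fromCols, hW,
        hw, hWw, hwW, Matrix.fromBlocks_one, Matrix.submatrix_one_equiv]
    have act : ∀ (Y : Matrix (Fin n) (Fin n) 𝕂) (W Z : Matrix (Fin n) (Fin k) 𝕂)
        (w z : Matrix (Fin n) (Fin 1) 𝕂),
        Y * W = Z * Matrix.diagonal (fun j => algebraMap ℝ 𝕂 (s j)) → Y * w = r • z →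
        Y * (Matrix.fromCols W w).submatrix id e = (Matrix.fromCols Z z).submatrix id e *
          Matrix.diagonal (fun j => algebraMap ℝ 𝕂 (Sum.elim s (fun _ => r) (e j))) := by
      intro Y W Z w z h1 h2
      ext i j
      rw [Matrix.mul_diagonal]
      have : (Y * (Matrix.fromCols W w).submatrix id e) i j = (Y * Matrix.fromCols W w) i (e j) := by
        simp [Matrix.mul_apply]
      rw [this, Matrix.mul_fromCols, h1, h2, Matrix.submatrix_apply]
      rcases e j with a | a
      · simp
      · simp [Algebra.smul_def, Algebra.commutes]
    refine ⟨(Matrix.fromCols V v).submatrix id e, (Matrix.fromCols U u).submatrix id e,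
      fun j => Sum.elim s (fun _ => r) (e j), ?_, gram V v hV hvv hVv, gram U u hU huu hUu,
      act X V U v u hXV hXv, act Xᴴ U V u v hXU hXu⟩
    intro j
    rcases h : e j with a | a
    · simpa [h] using hs a
    · simpa [h] using hr

/-- The singular value decomposition `X = U diag(s) V*` over the real, complex or quaternionic
numbers. -/
theorem exists_singular_value_decomposition [StarModule ℝ 𝕂] [FiniteDimensional ℝ 𝕂]
    {n : ℕ} (X : Matrix (Fin n) (Fin n) 𝕂) :
    ∃ (V U : Matrix (Fin n) (Fin n) 𝕂) (s : Fin n → ℝ), (∀ j, 0 ≤ s j) ∧ Vᴴ * V = 1 ∧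
      Uᴴ * U = 1 ∧ X = U * Matrix.diagonal (fun j => algebraMap ℝ 𝕂 (s j)) * Vᴴ := by
  obtain ⟨V, U, s, hs, hV, hU, hXV, -⟩ := exists_partial_singular_value_decomposition X n le_rfl
  refine ⟨V, U, s, hs, hV, hU, ?_⟩
  rw [← hXV, Matrix.mul_assoc, mul_eq_one_comm.1 hV, Matrix.mul_one]

end SingularValues

/-! ### Kernel and eigenspace dimensions read off from a decomposition -/

theorem mulVec_injective_of_conjTranspose_mul_eq_one {𝕂 : Type*} [DivisionRing 𝕂]
    [StarRing 𝕂] {n : ℕ} {V : Matrix (Fin n) (Fin n) 𝕂}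
    (hV : Vᴴ * V = 1) : Function.Injective (V *ᵥ ·) := fun v w h => by
  have := congrArg (Vᴴ *ᵥ ·) h
  simpa [Matrix.mulVec_mulVec, hV] using this

/-- In the coordinates `V* v`, `W` is a coordinate subspace. The coordinates are taken in `𝕂ᵐᵒᵖ`
because scalars act on the right. -/
theorem nonempty_linearEquiv_of_mem_iff {𝕂 : Type*} [DivisionRing 𝕂] [StarRing 𝕂] {n : ℕ} {V : Matrix (Fin n) (Fin n) 𝕂} (hV : Vᴴ * V = 1)
    (p : Fin n → Prop) (W : Submodule 𝕂ᵐᵒᵖ (Fin n → 𝕂))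
    (hW : ∀ v, v ∈ W ↔ ∀ j, ¬p j → (Vᴴ *ᵥ v) j = 0) :
    Nonempty (W ≃ₗ[𝕂ᵐᵒᵖ] ({j // p j} → 𝕂ᵐᵒᵖ)) := by
  classical
  have hV' : V * Vᴴ = 1 := mul_eq_one_comm.1 hV
  let ext0 : ({j // p j} → 𝕂ᵐᵒᵖ) → Fin n → 𝕂 := fun w j =>
    if h : p j then (w ⟨j, h⟩).unop else 0
  exact ⟨{
    toFun := fun v j => MulOpposite.op ((Vᴴ *ᵥ (v : Fin n → 𝕂)) j)
    map_add' := fun v w => by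
      ext j
      simp [Matrix.mulVec_add]
    map_smul' := fun c v => by
      ext j
      simp [Matrix.mulVec_smul]
    invFun := fun w => ⟨V *ᵥ ext0 w, (hW _).2 fun j hj => by
      rw [Matrix.mulVec_mulVec, hV, Matrix.one_mulVec]
      simp [ext0, hj]⟩
    left_inv := fun v => by
      apply Subtype.ext
      change V *ᵥ _ = _
      have : ext0 (fun j => MulOpposite.op ((Vᴴ *ᵥ (v : Fin n → 𝕂)) j)) = Vᴴ *ᵥ (v : Fin n → 𝕂) := by
        ext j
        by_cases hj : p j
        · simp [ext0, hj]
        · simp [ext0, hj, (hW _).1 v.2 j hj]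
      rw [this, Matrix.mulVec_mulVec, hV', Matrix.one_mulVec]
    right_inv := fun w => by
      ext j
      change MulOpposite.op ((Vᴴ *ᵥ (V *ᵥ ext0 w)) j) = w j
      rw [Matrix.mulVec_mulVec, hV, Matrix.one_mulVec]
      simp [ext0, j.2] }⟩

theorem finrank_eq_card_of_mem_iff {𝕂 : Type*} [DivisionRing 𝕂] [StarRing 𝕂] {n : ℕ} {V : Matrix (Fin n) (Fin n) 𝕂} (hV : Vᴴ * V = 1)
    (p : Fin n → Prop) [DecidablePred p] (W : Submodule 𝕂ᵐᵒᵖ (Fin n → 𝕂))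
    (hW : ∀ v, v ∈ W ↔ ∀ j, ¬p j → (Vᴴ *ᵥ v) j = 0) :
    Module.finrank 𝕂ᵐᵒᵖ W = Fintype.card {j // p j} := by
  obtain ⟨e⟩ := nonempty_linearEquiv_of_mem_iff hV p W hW
  rw [e.finrank_eq, Module.finrank_fintype_fun_eq_card]

theorem ne_bot_iff_of_mem_iff {𝕂 : Type*} [DivisionRing 𝕂] [StarRing 𝕂] {n : ℕ} {V : Matrix (Fin n) (Fin n) 𝕂} (hV : Vᴴ * V = 1)
    (p : Fin n → Prop) (W : Submodule 𝕂ᵐᵒᵖ (Fin n → 𝕂))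
    (hW : ∀ v, v ∈ W ↔ ∀ j, ¬p j → (Vᴴ *ᵥ v) j = 0) :
    W ≠ ⊥ ↔ ∃ j, p j := by
  obtain ⟨e⟩ := nonempty_linearEquiv_of_mem_iff hV p W hW
  rw [← Submodule.nontrivial_iff_ne_bot, e.toEquiv.nontrivial_congr]
  constructor
  · intro h
    by_contra! hp
    have : IsEmpty {j // p j} := ⟨fun j => hp j j.2⟩
    exact not_subsingleton _ (inferInstance : Subsingleton ({j // p j} → 𝕂ᵐᵒᵖ))
  · rintro ⟨j, hj⟩
    have : Nonempty {j // p j} := ⟨⟨j, hj⟩⟩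
    infer_instance

section Multiplicities

variable {𝕂 : Type*} [NormedDivisionRing 𝕂] [StarRing 𝕂] [NormedAlgebra ℝ 𝕂]

theorem conjTranspose_diagonal_algebraMap [StarModule ℝ 𝕂] {ι : Type*} [DecidableEq ι]
    (s : ι → ℝ) : (Matrix.diagonal fun j => algebraMap ℝ 𝕂 (s j))ᴴ
      = Matrix.diagonal fun j => algebraMap ℝ 𝕂 (s j) := by
  rw [Matrix.diagonal_conjTranspose]
  congr 1; ext j
  simp [← algebraMap_star_comm]

theorem mem_rightKernel_iff {n : ℕ} {V U : Matrix (Fin n) (Fin n) 𝕂} (hU : Uᴴ * U = 1)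
    (s : Fin n → ℝ) (v : Fin n → 𝕂) :
    v ∈ rightKernel (U * Matrix.diagonal (fun j => algebraMap ℝ 𝕂 (s j)) * Vᴴ) ↔
      ∀ j, ¬s j = 0 → (Vᴴ *ᵥ v) j = 0 := by
  change _ *ᵥ v = 0 ↔ _
  rw [← Matrix.mulVec_mulVec, ← Matrix.mulVec_mulVec]
  rw [(mulVec_injective_of_conjTranspose_mul_eq_one hU).eq_iff' (Matrix.mulVec_zero U),
    funext_iff]
  refine forall_congr' fun j => ?_
  rw [Matrix.mulVec_diagonal]
  simp [or_iff_not_imp_left]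

/-- `X X* = U D² U*`, so eigenspaces are read in the columns of `U`, whereas the kernel of `X` is
read in those of `V`. -/
theorem mem_realEigenspace_iff [StarModule ℝ 𝕂] {n : ℕ} {V U : Matrix (Fin n) (Fin n) 𝕂}
    (hV : Vᴴ * V = 1) (hU : Uᴴ * U = 1) (s : Fin n → ℝ) (c : ℝ) (v : Fin n → 𝕂) :
    v ∈ realEigenspace ((U * Matrix.diagonal (fun j => algebraMap ℝ 𝕂 (s j)) * Vᴴ) *
        (U * Matrix.diagonal (fun j => algebraMap ℝ 𝕂 (s j)) * Vᴴ)ᴴ) c ↔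
      ∀ j, ¬s j ^ 2 = c → (Uᴴ *ᵥ v) j = 0 := by
  have hU' : U * Uᴴ = 1 := mul_eq_one_comm.1 hU
  change _ *ᵥ v = c • v ↔ _
  set D := Matrix.diagonal fun j => algebraMap ℝ 𝕂 (s j) with hD
  have h1 : U * D * Vᴴ * (U * D * Vᴴ)ᴴ = U * (D * D * Uᴴ) := by
    rw [Matrix.conjTranspose_mul, Matrix.conjTranspose_mul, Matrix.conjTranspose_conjTranspose,
      hD, conjTranspose_diagonal_algebraMap, ← hD, Matrix.mul_assoc (U * D),
      ← Matrix.mul_assoc Vᴴ, hV, Matrix.one_mul]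
    simp only [Matrix.mul_assoc]
  have h2 : c • v = U *ᵥ (c • (Uᴴ *ᵥ v)) := by
    rw [Matrix.mulVec_smul, Matrix.mulVec_mulVec, hU', Matrix.one_mulVec]
  rw [h1, h2, ← Matrix.mulVec_mulVec, (mulVec_injective_of_conjTranspose_mul_eq_one hU).eq_iff,
    ← Matrix.mulVec_mulVec, hD, Matrix.diagonal_mul_diagonal, funext_iff]
  refine forall_congr' fun j => ?_
  rw [Matrix.mulVec_diagonal, ← map_mul, ← Algebra.smul_def, Pi.smul_apply, ← sub_eq_zero,
    ← sub_smul, smul_eq_zero, sub_eq_zero, sq, or_iff_not_imp_left]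

/-- A singular value decomposition of `X` indexed by the kernel and by the nonzero eigenvalues
of `X X*`. -/
theorem exists_adapted_singular_value_decomposition [StarModule ℝ 𝕂] [FiniteDimensional ℝ 𝕂]
    [StarMulSelfEqNormSq 𝕂] {n : ℕ} (X : Matrix (Fin n) (Fin n) 𝕂) {n₀ k : ℕ} {t : Fin k → ℝ}
    {m : Fin k → ℕ} (h₀ : Module.finrank 𝕂ᵐᵒᵖ (rightKernel X) = n₀) (ht : StrictMono t)
    (hr : Set.range t = {s : ℝ | s ≠ 0 ∧ realEigenspace (X * Xᴴ) s ≠ ⊥})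
    (hm : ∀ i, Module.finrank 𝕂ᵐᵒᵖ (realEigenspace (X * Xᴴ) (t i)) = m i) :
    (∀ i, 0 < t i) ∧ n₀ + ∑ i, m i = n ∧
      ∃ V U : Matrix (Fin n) (Fin n₀ ⊕ Σ i, Fin (m i)) 𝕂, Vᴴ * V = 1 ∧ V * Vᴴ = 1 ∧
        Uᴴ * U = 1 ∧ U * Uᴴ = 1 ∧
        X = U * Matrix.diagonal (fun j => algebraMap ℝ 𝕂
          (Sum.elim (fun _ : Fin n₀ => 0) (fun a : Σ i, Fin (m i) => √(t a.1)) j)) * Vᴴ := by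
  obtain ⟨V, U, s, hs, hV, hU, rfl⟩ := exists_singular_value_decomposition X
  have hV' : V * Vᴴ = 1 := mul_eq_one_comm.1 hV
  have hU' : U * Uᴴ = 1 := mul_eq_one_comm.1 hU
  have hker := mem_rightKernel_iff (V := V) hU s
  have heig := mem_realEigenspace_iff hV hU s
  rw [finrank_eq_card_of_mem_iff hV (fun j => s j = 0) _ hker] at h₀
  have hm' : ∀ i, Fintype.card {j // s j ^ 2 = t i} = m i := fun i => by
    rw [← hm i, finrank_eq_card_of_mem_iff hU (fun j => s j ^ 2 = t i) _ (heig (t i))]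
  have hr' : ∀ c, (∃ i, t i = c) ↔ c ≠ 0 ∧ ∃ j, s j ^ 2 = c := fun c => by
    rw [← ne_bot_iff_of_mem_iff hU (fun j => s j ^ 2 = c) _ (heig c)]
    exact Set.ext_iff.1 hr c
  have htpos : ∀ i, 0 < t i := fun i => by
    obtain ⟨h0, j, hj⟩ := (hr' (t i)).1 ⟨i, rfl⟩
    exact lt_of_le_of_ne (hj ▸ sq_nonneg _) h0.symm
  let e₀ : Fin n₀ ≃ {j // s j = 0} := (Fintype.equivFinOfCardEq h₀).symm
  let e : ∀ i, Fin (m i) ≃ {j // s j ^ 2 = t i} := fun i =>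
    (Fintype.equivFinOfCardEq (hm' i)).symm
  let E : (Fin n₀ ⊕ Σ i, Fin (m i)) → Fin n :=
    Sum.elim (fun a => (e₀ a : Fin n)) (fun a => (e a.1 a.2 : Fin n))
  -- The fibres `s = 0` and `s² = t i` are disjoint, as the `t i` are positive and distinct, and
  -- they exhaust the indices, as every nonzero `s j ^ 2` is an eigenvalue.
  have hE : Function.Bijective E := by
    constructor
    · rintro (a | ⟨i, a⟩) (b | ⟨j, b⟩) h
      · exact congrArg _ (e₀.injective (Subtype.ext h))
      · have h1 : (e₀ a : Fin n) = e j b := h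
        have h2 := (e j b).2
        rw [← h1, (e₀ a).2] at h2
        exact absurd h2 (by simpa using (htpos j).ne)
      · have h1 : (e i a : Fin n) = e₀ b := h
        have h2 := (e i a).2
        rw [h1, (e₀ b).2] at h2
        exact absurd h2 (by simpa using (htpos i).ne)
      · have h1 : (e i a : Fin n) = e j b := h
        obtain rfl : i = j := ht.injective (by rw [← (e i a).2, ← (e j b).2, h1])
        rw [(e i).injective (Subtype.ext h1)]
    · intro j
      by_cases hj : s j = 0
      · exact ⟨Sum.inl (e₀.symm ⟨j, hj⟩), by simp [E]⟩
      · obtain ⟨i, hi⟩ := (hr' (s j ^ 2)).2 ⟨pow_ne_zero 2 hj, j, rfl⟩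
        exact ⟨Sum.inr ⟨i, (e i).symm ⟨j, hi.symm⟩⟩, by simp [E]⟩
  let E' := Equiv.ofBijective E hE
  refine ⟨htpos, ?_, V.submatrix id E', U.submatrix id E', ?_, ?_, ?_, ?_, ?_⟩
  · simpa using Fintype.card_congr E'
  · rw [Matrix.conjTranspose_submatrix,
      ← Matrix.submatrix_mul _ _ E' id E' Function.bijective_id, hV, Matrix.submatrix_one_equiv]
  · rw [Matrix.conjTranspose_submatrix, Matrix.submatrix_mul_equiv, hV', Matrix.submatrix_id_id]
  · rw [Matrix.conjTranspose_submatrix,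
      ← Matrix.submatrix_mul _ _ E' id E' Function.bijective_id, hU, Matrix.submatrix_one_equiv]
  · rw [Matrix.conjTranspose_submatrix, Matrix.submatrix_mul_equiv, hU', Matrix.submatrix_id_id]
  · have hD : (Matrix.diagonal fun j => algebraMap ℝ 𝕂
        (Sum.elim (fun _ : Fin n₀ => 0) (fun a : Σ i, Fin (m i) => √(t a.1)) j))
        = (Matrix.diagonal fun j => algebraMap ℝ 𝕂 (s j)).submatrix E' E' := by
      rw [Matrix.submatrix_diagonal_equiv]
      congr 1
      ext j
      rcases j with a | ⟨i, a⟩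
      · have : s (E' (Sum.inl a)) = 0 := (e₀ a).2
        simp [this]
      · have : s (E' (Sum.inr ⟨i, a⟩)) ^ 2 = t i := (e i a).2
        simp [← this, Real.sqrt_sq (hs _)]
    rw [hD, Matrix.conjTranspose_submatrix, Matrix.submatrix_mul_equiv,
      Matrix.submatrix_mul_equiv, Matrix.submatrix_id_id]

end Multiplicities

/-! ### Diffeomorphisms induced by ambient linear maps -/

section LinearDiffeomorphisms

variable {E F : Type*} [NormedAddCommGroup E] [NormedSpace ℝ E] [FiniteDimensional ℝ E]
  [NormedAddCommGroup F] [NormedSpace ℝ F]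

theorem contDiff_of_isLinearMap {f : E → F} (hf : IsLinearMap ℝ f) : ContDiff ℝ ∞ f :=
  (LinearMap.toContinuousLinearMap hf.mk').contDiff

/-- The maps need to be mutually inverse only on the subsets, so the ambient spaces may have
different dimensions. -/
theorem areDiffeomorphic_of_isLinearMap [FiniteDimensional ℝ F] {S : Set E} {T : Set F}
    {f : E → F} {g : F → E} (hf : IsLinearMap ℝ f) (hg : IsLinearMap ℝ g)
    (hfS : ∀ x ∈ S, f x ∈ T) (hgT : ∀ y ∈ T, g y ∈ S) (hgf : ∀ x ∈ S, g (f x) = x)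
    (hfg : ∀ y ∈ T, f (g y) = y) : AreDiffeomorphic S T := by
  refine ⟨⟨fun x => ⟨f x, hfS x x.2⟩, fun y => ⟨g y, hgT y y.2⟩,
    fun x => Subtype.ext (hgf x x.2), fun y => Subtype.ext (hfg y y.2)⟩, ?_, ?_⟩
  · exact fun x => ⟨Set.univ, isOpen_univ, trivial, f, (contDiff_of_isLinearMap hf).contDiffOn,
      fun _ _ => rfl⟩
  · exact fun y => ⟨Set.univ, isOpen_univ, trivial, g, (contDiff_of_isLinearMap hg).contDiffOn,
      fun _ _ => rfl⟩

end LinearDiffeomorphisms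

/-! ### Block structure of the transformed critical set -/

section Blocks

/-- `B D = D B*` and unitarity also give `D B = B* D`; hence `B` commutes with `D²`, and an entry
joining different eigenvalues of `D²` vanishes. -/
theorem mul_apply_eq_zero_of_ne {𝕂 : Type*} [NormedDivisionRing 𝕂] [StarRing 𝕂]
    [NormedAlgebra ℝ 𝕂] {ι : Type*} [Fintype ι] [DecidableEq ι] {d : ι → ℝ}
    {B : Matrix ι ι 𝕂} (hB : B * Bᴴ = 1)
    (h : B * Matrix.diagonal (fun j => algebraMap ℝ 𝕂 (d j)) =
      Matrix.diagonal (fun j => algebraMap ℝ 𝕂 (d j)) * Bᴴ) {i j : ι} (hij : d i ^ 2 ≠ d j ^ 2) :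
    B i j = 0 := by
  set D := Matrix.diagonal fun j => algebraMap ℝ 𝕂 (d j) with hD
  have hB' : Bᴴ * B = 1 := mul_eq_one_comm.1 hB
  have h1 : D * B = Bᴴ * D := by
    calc D * B = Bᴴ * (B * D) * B := by rw [← Matrix.mul_assoc Bᴴ, hB', Matrix.one_mul]
      _ = Bᴴ * D := by rw [h, Matrix.mul_assoc, Matrix.mul_assoc, hB', Matrix.mul_one]
  have h2 : B * (D * D) = D * D * B := by
    rw [← Matrix.mul_assoc, h, Matrix.mul_assoc, ← h1, Matrix.mul_assoc]
  have h3 := congrFun (congrFun h2 i) j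
  rw [hD, Matrix.diagonal_mul_diagonal, Matrix.mul_diagonal, Matrix.diagonal_mul, ← map_mul,
    ← map_mul, ← Algebra.commutes, ← sub_eq_zero, ← sub_mul, ← map_sub, mul_eq_zero,
    map_eq_zero, sub_eq_zero] at h3
  refine h3.resolve_left fun h4 => hij ?_
  rw [sq, sq, h4]

variable {𝕂 : Type*} [NormedDivisionRing 𝕂] [StarRing 𝕂] [NormedAlgebra ℝ 𝕂]
  {n₀ k : ℕ} {m : Fin k → ℕ}

/-- The solutions of `B B* = 1`, `B D = D B*` for `D = diag(0, √t₁, …, √tₖ)`: they are the block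
diagonal matrices built from an orthogonal matrix and orthogonal involutions. -/
theorem fromBlocks_blockDiagonal'_mem_iff {t : Fin k → ℝ} (htpos : ∀ i, 0 < t i)
    (B₀ : Matrix (Fin n₀) (Fin n₀) 𝕂) (B : ∀ i, Matrix (Fin (m i)) (Fin (m i)) 𝕂) :
    (Matrix.fromBlocks B₀ 0 0 (Matrix.blockDiagonal' B) *
        (Matrix.fromBlocks B₀ 0 0 (Matrix.blockDiagonal' B))ᴴ = 1 ∧
      Matrix.fromBlocks B₀ 0 0 (Matrix.blockDiagonal' B) * Matrix.diagonal (fun j =>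
          algebraMap ℝ 𝕂 (Sum.elim (fun _ : Fin n₀ => 0) (fun a : Σ i, Fin (m i) => √(t a.1)) j)) =
        Matrix.diagonal (fun j => algebraMap ℝ 𝕂
          (Sum.elim (fun _ : Fin n₀ => 0) (fun a : Σ i, Fin (m i) => √(t a.1)) j)) *
          (Matrix.fromBlocks B₀ 0 0 (Matrix.blockDiagonal' B))ᴴ) ↔
      B₀ ∈ orthogonalMatrices n₀ 𝕂 ∧ ∀ i, B i ∈ orthogonalInvolutions (m i) 𝕂 := by
  have hD : (Matrix.diagonal fun j => algebraMap ℝ 𝕂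
      (Sum.elim (fun _ : Fin n₀ => 0) (fun a : Σ i, Fin (m i) => √(t a.1)) j))
      = Matrix.fromBlocks 0 0 0 (Matrix.blockDiagonal' fun i =>
          √(t i) • (1 : Matrix (Fin (m i)) (Fin (m i)) 𝕂)) := by
    have h1 : (Matrix.blockDiagonal' fun i => √(t i) • (1 : Matrix (Fin (m i)) (Fin (m i)) 𝕂))
        = Matrix.diagonal fun a : Σ i, Fin (m i) => algebraMap ℝ 𝕂 √(t a.1) := by
      rw [← Matrix.blockDiagonal'_diagonal (fun i (_ : Fin (m i)) => algebraMap ℝ 𝕂 √(t i))]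
      congr 1
      ext i a b
      simp [Matrix.one_apply, Matrix.diagonal_apply, Algebra.algebraMap_eq_smul_one]
    rw [h1, ← Matrix.diagonal_zero, Matrix.fromBlocks_diagonal]
    congr 1
    ext j
    rcases j with a | a <;> simp
  have hone : (1 : Matrix (Fin n₀ ⊕ Σ i, Fin (m i)) (Fin n₀ ⊕ Σ i, Fin (m i)) 𝕂)
      = Matrix.fromBlocks 1 0 0 (Matrix.blockDiagonal' fun _ => 1) := by
    have : (Matrix.blockDiagonal' fun i => (1 : Matrix (Fin (m i)) (Fin (m i)) 𝕂)) = 1 :=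
      Matrix.blockDiagonal'_one
    rw [this, Matrix.fromBlocks_one]
  rw [hD, hone, Matrix.fromBlocks_conjTranspose, Matrix.fromBlocks_multiply,
    Matrix.fromBlocks_multiply, Matrix.fromBlocks_multiply, Matrix.fromBlocks_inj,
    Matrix.fromBlocks_inj, Matrix.blockDiagonal'_conjTranspose]
  simp only [Matrix.conjTranspose_zero, Matrix.mul_zero, Matrix.zero_mul, add_zero, zero_add,
    ← Matrix.blockDiagonal'_mul, Matrix.blockDiagonal'_inj, funext_iff, true_and, Matrix.mul_smul,
    Matrix.smul_mul, Matrix.mul_one, Matrix.one_mul]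
  have hsm : ∀ i, (√(t i) • B i = √(t i) • (B i)ᴴ) ↔ B i = (B i)ᴴ := fun i =>
    (smul_right_injective _ (Real.sqrt_pos.2 (htpos i)).ne').eq_iff
  simp only [hsm]
  rw [and_assoc, ← forall_and]
  refine and_congr Iff.rfl (forall_congr' fun i => ?_)
  change _ ↔ B i * (B i)ᴴ = 1 ∧ B i * B i = 1
  -- For an orthogonal matrix, being Hermitian is the same as being an involution.
  refine and_congr_right fun h => ⟨fun h' => ?_, fun h' => ?_⟩
  · rwa [← h'] at h
  · have h1 : (B i)ᴴ * B i = 1 := mul_eq_one_comm.1 h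
    calc B i = (B i)ᴴ * B i * B i := by rw [h1, Matrix.one_mul]
      _ = (B i)ᴴ := by rw [Matrix.mul_assoc, h', Matrix.mul_one]

theorem eq_fromBlocks_blockDiagonal' {t : Fin k → ℝ} (htpos : ∀ i, 0 < t i)
    (ht : Function.Injective t)
    {B : Matrix (Fin n₀ ⊕ Σ i, Fin (m i)) (Fin n₀ ⊕ Σ i, Fin (m i)) 𝕂} (hB : B * Bᴴ = 1)
    (h : B * Matrix.diagonal (fun j => algebraMap ℝ 𝕂
        (Sum.elim (fun _ : Fin n₀ => 0) (fun a : Σ i, Fin (m i) => √(t a.1)) j)) =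
      Matrix.diagonal (fun j => algebraMap ℝ 𝕂
        (Sum.elim (fun _ : Fin n₀ => 0) (fun a : Σ i, Fin (m i) => √(t a.1)) j)) * Bᴴ) :
    Matrix.fromBlocks B.toBlocks₁₁ 0 0 (Matrix.blockDiagonal' B.toBlocks₂₂.blockDiag') = B := by
  have key := fun i j => mul_apply_eq_zero_of_ne hB h (i := i) (j := j)
  ext i j
  rcases i with a | ⟨i, a⟩ <;> rcases j with b | ⟨j, b⟩
  · rfl
  · refine (key _ _ ?_).symm
    simpa [Real.sq_sqrt (htpos j).le] using (htpos j).ne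
  · refine (key _ _ ?_).symm
    simpa [Real.sq_sqrt (htpos i).le] using (htpos i).ne'
  · by_cases hij : i = j
    · subst hij
      simp [Matrix.blockDiag'_apply, Matrix.toBlocks₂₂]
    · rw [Matrix.fromBlocks_apply₂₂, Matrix.blockDiagonal'_apply_ne _ _ _ hij]
      refine (key _ _ ?_).symm
      simpa [Real.sq_sqrt (htpos i).le, Real.sq_sqrt (htpos j).le] using ht.ne hij

/-- The matrices with `A A* = 1` and `A X = X* A*` for `X = U D V*` correspond, under
`A ↦ V* A U`, to the products of an orthogonal matrix and orthogonal involutions. -/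
theorem areDiffeomorphic_orthogonal_prod_involutions [StarModule ℝ 𝕂]
    [FiniteDimensional ℝ 𝕂] {n : ℕ}
    {X : Matrix (Fin n) (Fin n) 𝕂} {t : Fin k → ℝ} (htpos : ∀ i, 0 < t i)
    (ht : Function.Injective t) {V U : Matrix (Fin n) (Fin n₀ ⊕ Σ i, Fin (m i)) 𝕂}
    (hV : Vᴴ * V = 1) (hV' : V * Vᴴ = 1) (hU : Uᴴ * U = 1) (hU' : U * Uᴴ = 1)
    (hX : X = U * Matrix.diagonal (fun j => algebraMap ℝ 𝕂
          (Sum.elim (fun _ : Fin n₀ => 0) (fun a : Σ i, Fin (m i) => √(t a.1)) j)) * Vᴴ) :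
    AreDiffeomorphic {A : Matrix (Fin n) (Fin n) 𝕂 | A * Aᴴ = 1 ∧ A * X = Xᴴ * Aᴴ}
      (orthogonalMatrices n₀ 𝕂 ×ˢ Set.univ.pi fun i => orthogonalInvolutions (m i) 𝕂) := by
  set D := Matrix.diagonal (fun j => algebraMap ℝ 𝕂
    (Sum.elim (fun _ : Fin n₀ => 0) (fun a : Σ i, Fin (m i) => √(t a.1)) j)) with hD
  have hDD : Dᴴ = D := conjTranspose_diagonal_algebraMap _
  have cancel : ∀ A : Matrix (Fin n) (Fin n) 𝕂, V * (Vᴴ * A * U) * Uᴴ = A := fun A => by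
    rw [Matrix.mul_assoc Vᴴ, ← Matrix.mul_assoc V, hV', Matrix.one_mul, Matrix.mul_assoc, hU',
      Matrix.mul_one]
  have cancel' : ∀ B : Matrix (Fin n₀ ⊕ Σ i, Fin (m i)) (Fin n₀ ⊕ Σ i, Fin (m i)) 𝕂,
      Vᴴ * (V * B * Uᴴ) * U = B := fun B => by
    rw [Matrix.mul_assoc V, ← Matrix.mul_assoc Vᴴ, hV, Matrix.one_mul, Matrix.mul_assoc, hU,
      Matrix.mul_one]
  -- Under `A = V B U*` the factors `U` cancel in `A A*` and in `A X`; each equation becomes its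
  -- counterpart for `B` conjugated by `V`.
  have hmem : ∀ B : Matrix (Fin n₀ ⊕ Σ i, Fin (m i)) (Fin n₀ ⊕ Σ i, Fin (m i)) 𝕂,
      (V * B * Uᴴ * (V * B * Uᴴ)ᴴ = 1 ∧ V * B * Uᴴ * X = Xᴴ * (V * B * Uᴴ)ᴴ) ↔
        (B * Bᴴ = 1 ∧ B * D = D * Bᴴ) := by
    intro B
    have inj : ∀ M N : Matrix (Fin n₀ ⊕ Σ i, Fin (m i)) (Fin n₀ ⊕ Σ i, Fin (m i)) 𝕂,
        V * M * Vᴴ = V * N * Vᴴ ↔ M = N := fun M N => by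
      refine ⟨fun h => ?_, fun h => by rw [h]⟩
      have := congrArg (fun Z => Vᴴ * Z * V) h
      simpa only [Matrix.mul_assoc, hV, Matrix.mul_one, ← Matrix.mul_assoc Vᴴ V,
        Matrix.one_mul] using this
    have e1 : V * B * Uᴴ * (V * B * Uᴴ)ᴴ = V * (B * Bᴴ) * Vᴴ := by
      simp only [Matrix.conjTranspose_mul, Matrix.conjTranspose_conjTranspose, Matrix.mul_assoc]
      rw [← Matrix.mul_assoc Uᴴ, hU, Matrix.one_mul]
    have e2 : V * B * Uᴴ * X = V * (B * D) * Vᴴ := by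
      rw [hX]
      simp only [Matrix.mul_assoc]
      rw [← Matrix.mul_assoc Uᴴ, hU, Matrix.one_mul]
    have e3 : Xᴴ * (V * B * Uᴴ)ᴴ = V * (D * Bᴴ) * Vᴴ := by
      rw [hX]
      simp only [Matrix.conjTranspose_mul, Matrix.conjTranspose_conjTranspose, Matrix.mul_assoc,
        hDD]
      rw [← Matrix.mul_assoc Uᴴ, hU, Matrix.one_mul]
    have e4 : (1 : Matrix (Fin n) (Fin n) 𝕂) =
        V * (1 : Matrix (Fin n₀ ⊕ Σ i, Fin (m i)) (Fin n₀ ⊕ Σ i, Fin (m i)) 𝕂) * Vᴴ := by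
      rw [Matrix.mul_one, hV']
    rw [e1, e2, e3, e4, inj, inj]
  have hmem' : ∀ A : Matrix (Fin n) (Fin n) 𝕂, (A * Aᴴ = 1 ∧ A * X = Xᴴ * Aᴴ) →
      Matrix.fromBlocks (Vᴴ * A * U).toBlocks₁₁ 0 0
        (Matrix.blockDiagonal' (Vᴴ * A * U).toBlocks₂₂.blockDiag') = Vᴴ * A * U := by
    intro A hA
    rw [← cancel A, hmem] at hA
    exact eq_fromBlocks_blockDiagonal' htpos ht hA.1 hA.2
  -- `f` discards the off-diagonal blocks, which `hmem'` shows to vanish on the critical set.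
  refine areDiffeomorphic_of_isLinearMap
    (f := fun A => ((Vᴴ * A * U).toBlocks₁₁, (Vᴴ * A * U).toBlocks₂₂.blockDiag'))
    (g := fun B => V * Matrix.fromBlocks B.1 0 0 (Matrix.blockDiagonal' B.2) * Uᴴ)
    ⟨fun A B => ?_, fun c A => ?_⟩ ⟨fun A B => ?_, fun c A => ?_⟩ ?_ ?_ ?_ ?_
  · rw [Matrix.mul_add, Matrix.add_mul]; rfl
  · rw [Matrix.mul_smul, Matrix.smul_mul]; rfl
  · have : Matrix.fromBlocks (A + B).1 0 0 (Matrix.blockDiagonal' (A + B).2) =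
        Matrix.fromBlocks A.1 0 0 (Matrix.blockDiagonal' A.2) +
        Matrix.fromBlocks B.1 0 0 (Matrix.blockDiagonal' B.2) := by
      rw [Matrix.fromBlocks_add, ← Matrix.blockDiagonal'_add, Prod.fst_add, Prod.snd_add,
        add_zero, add_zero]
    rw [this, Matrix.mul_add, Matrix.add_mul]
  · have : Matrix.fromBlocks (c • A).1 0 0 (Matrix.blockDiagonal' (c • A).2) =
        c • Matrix.fromBlocks A.1 0 0 (Matrix.blockDiagonal' A.2) := by
      rw [Matrix.fromBlocks_smul, ← Matrix.blockDiagonal'_smul, Prod.smul_fst, Prod.smul_snd,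
        smul_zero, smul_zero]
    rw [this, Matrix.mul_smul, Matrix.smul_mul]
  · intro A hA
    have h1 := hmem' A hA
    have h2 : (A * Aᴴ = 1 ∧ A * X = Xᴴ * Aᴴ) := hA
    rw [← cancel A, hmem, ← h1, hD, fromBlocks_blockDiagonal'_mem_iff htpos] at h2
    exact ⟨h2.1, fun i _ => h2.2 i⟩
  · rintro B ⟨hB₀, hB⟩
    refine (hmem _).2 ((fromBlocks_blockDiagonal'_mem_iff htpos _ _).2 ⟨hB₀, fun i => ?_⟩)
    exact hB i trivial
  · intro A hA
    change V * Matrix.fromBlocks (Vᴴ * A * U).toBlocks₁₁ 0 0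
      (Matrix.blockDiagonal' (Vᴴ * A * U).toBlocks₂₂.blockDiag') * Uᴴ = A
    rw [hmem' A hA, cancel]
  · intro B _
    rw [cancel', Matrix.toBlocks_fromBlocks₁₁, Matrix.toBlocks_fromBlocks₂₂,
      Matrix.blockDiag'_blockDiagonal']

end Blocks

/-! ### The real part of the trace -/

section RealPart

variable {𝕂 : Type*} [NormedDivisionRing 𝕂] [StarRing 𝕂] [NormedAlgebra ℝ 𝕂]

/-- The algebraic properties of the real part of a real, complex or quaternionic number. -/
structure IsRealPart (re : 𝕂 → ℝ) : Prop where
  map_add : ∀ x y, re (x + y) = re x + re y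
  map_smul : ∀ (c : ℝ) x, re (c • x) = c * re x
  mul_comm : ∀ x y, re (x * y) = re (y * x)
  map_star : ∀ x, re (star x) = re x
  map_algebraMap : ∀ c : ℝ, re (algebraMap ℝ 𝕂 c) = c

variable {re : 𝕂 → ℝ} {n : ℕ}

/-- The real part, as a real linear map. -/
def IsRealPart.toLinearMap (hre : IsRealPart re) : 𝕂 →ₗ[ℝ] ℝ where
  toFun := re
  map_add' := hre.map_add
  map_smul' := hre.map_smul

/-- The real part of the trace, as a real linear map. -/
noncomputable def IsRealPart.traceLinearMap (hre : IsRealPart re) (n : ℕ) :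
    Matrix (Fin n) (Fin n) 𝕂 →ₗ[ℝ] ℝ :=
  hre.toLinearMap ∘ₗ Matrix.traceLinearMap (Fin n) ℝ 𝕂

theorem IsRealPart.traceLinearMap_eq_sum (hre : IsRealPart re) (A : Matrix (Fin n) (Fin n) 𝕂) :
    hre.traceLinearMap n A = ∑ i, re (A i i) :=
  map_sum hre.toLinearMap (fun i => A i i) Finset.univ

theorem IsRealPart.traceLinearMap_mul (hre : IsRealPart re) (A B : Matrix (Fin n) (Fin n) 𝕂) :
    hre.traceLinearMap n (A * B) = ∑ i, ∑ j, re (A i j * B j i) := by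
  rw [hre.traceLinearMap_eq_sum]
  exact Finset.sum_congr rfl fun i _ =>
    map_sum hre.toLinearMap (fun j => A i j * B j i) Finset.univ

/-- Over the quaternions the trace itself is not cyclic; its real part is, because `re (x y) = re (y
x)`. -/
theorem IsRealPart.traceLinearMap_mul_comm (hre : IsRealPart re)
    (A B : Matrix (Fin n) (Fin n) 𝕂) :
    hre.traceLinearMap n (A * B) = hre.traceLinearMap n (B * A) := by
  rw [hre.traceLinearMap_mul, hre.traceLinearMap_mul, Finset.sum_comm]
  exact Finset.sum_congr rfl fun i _ => Finset.sum_congr rfl fun j _ => hre.mul_comm _ _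

theorem IsRealPart.traceLinearMap_star (hre : IsRealPart re) (A : Matrix (Fin n) (Fin n) 𝕂) :
    hre.traceLinearMap n (star A) = hre.traceLinearMap n A := by
  rw [hre.traceLinearMap_eq_sum, hre.traceLinearMap_eq_sum]
  exact Finset.sum_congr rfl fun i _ => hre.map_star _

/-- `re Tr (A A*)` is the sum of all `‖A i j‖²`. -/
theorem IsRealPart.eq_zero_of_traceLinearMap_mul_star_eq_zero [StarMulSelfEqNormSq 𝕂]
    (hre : IsRealPart re) (A : Matrix (Fin n) (Fin n) 𝕂)
    (h : hre.traceLinearMap n (A * star A) = 0) : A = 0 := by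
  rw [hre.traceLinearMap_mul] at h
  have h1 : ∀ i j, re (A i j * star A j i) = ‖A i j‖ ^ 2 := fun i j => by
    rw [Matrix.star_apply, mul_star_self_eq, hre.map_algebraMap]
  simp only [h1] at h
  ext i j
  rw [Finset.sum_eq_zero_iff_of_nonneg
    fun i _ => Finset.sum_nonneg fun j _ => by positivity] at h
  have h2 := h i (Finset.mem_univ i)
  rw [Finset.sum_eq_zero_iff_of_nonneg fun j _ => by positivity] at h2
  simpa using h2 j (Finset.mem_univ j)

theorem heightCriticalSet_eq [StarMulSelfEqNormSq 𝕂] [FiniteDimensional ℝ 𝕂] [StarModule ℝ 𝕂]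
    (hre : IsRealPart re) (X : Matrix (Fin n) (Fin n) 𝕂) :
    heightCriticalSet re X = {A | A * Aᴴ = 1 ∧ A * X = Xᴴ * Aᴴ} :=
  Set.ext fun A => isCriticalPointOn_iff (hre.traceLinearMap n) hre.traceLinearMap_mul_comm
    hre.traceLinearMap_star hre.eq_zero_of_traceLinearMap_mul_star_eq_zero X A

theorem heightCriticalSet_isEmbeddedSubmanifold_and_areDiffeomorphic [StarMulSelfEqNormSq 𝕂]
    [FiniteDimensional ℝ 𝕂] [StarModule ℝ 𝕂] (hre : IsRealPart re)
    (X : Matrix (Fin n) (Fin n) 𝕂) (n₀ k : ℕ) (t : Fin k → ℝ) (m : Fin k → ℕ)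
    (h₀ : Module.finrank 𝕂ᵐᵒᵖ (rightKernel X) = n₀) (ht : StrictMono t)
    (hr : Set.range t = {s : ℝ | s ≠ 0 ∧ realEigenspace (X * Xᴴ) s ≠ ⊥})
    (hm : ∀ i, Module.finrank 𝕂ᵐᵒᵖ (realEigenspace (X * Xᴴ) (t i)) = m i) :
    (∀ i, 0 < t i) ∧ n₀ + ∑ i, m i = n ∧ IsEmbeddedSubmanifold (heightCriticalSet re X) ∧
      AreDiffeomorphic (heightCriticalSet re X)
        (orthogonalMatrices n₀ 𝕂 ×ˢ Set.univ.pi fun i => orthogonalInvolutions (m i) 𝕂) := by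
  obtain ⟨htpos, hsum, V, U, hV, hV', hU, hU', hX⟩ :=
    exists_adapted_singular_value_decomposition X h₀ ht hr hm
  refine ⟨htpos, hsum, ?_, ?_⟩
  · rw [heightCriticalSet_eq hre]
    exact isEmbeddedSubmanifold_criticalSet X
  · rw [heightCriticalSet_eq hre]
    exact areDiffeomorphic_orthogonal_prod_involutions htpos ht.injective hV hV' hU hU' hX

end RealPart

/-! ### The real, complex and quaternionic cases -/

instance : StarMulSelfEqNormSq ℝ where
  star_mul_self_eq x := by simp [← sq]

instance : StarMulSelfEqNormSq ℂ where
  star_mul_self_eq x := by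
    simpa [Complex.normSq_eq_norm_sq] using Complex.normSq_eq_conj_mul_self.symm

instance : StarMulSelfEqNormSq (Quaternion ℝ) where
  star_mul_self_eq x := by
    rw [Quaternion.star_mul_self, Quaternion.normSq_eq_norm_mul_self, ← sq]
    rfl

instance : StarModule ℝ (Quaternion ℝ) :=
  ⟨fun r x => Quaternion.star_smul r x⟩

theorem isRealPart_real : IsRealPart (fun x : ℝ => x) :=
  ⟨fun _ _ => rfl, fun _ _ => rfl, mul_comm, fun _ => rfl, fun _ => rfl⟩

theorem isRealPart_complex : IsRealPart Complex.re :=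
  ⟨Complex.add_re, fun c x => by simp, fun x y => by rw [mul_comm], fun _ => rfl, fun _ => rfl⟩

theorem isRealPart_quaternion : IsRealPart (fun q : Quaternion ℝ => q.re) :=
  ⟨fun _ _ => rfl, fun _ _ => rfl, fun x y => by simp only [Quaternion.re_mul]; ring,
    fun x => Quaternion.re_star x, fun _ => rfl⟩

theorem mainTheorem8 :
    (∀ (n : ℕ) (X : Matrix (Fin n) (Fin n) ℝ) (n₀ k : ℕ) (t : Fin k → ℝ) (m : Fin k → ℕ),
      Module.finrank ℝᵐᵒᵖ (rightKernel X) = n₀ →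
      StrictMono t →
      Set.range t = {s : ℝ | s ≠ 0 ∧ realEigenspace (X * Xᴴ) s ≠ ⊥} →
      (∀ i, Module.finrank ℝᵐᵒᵖ (realEigenspace (X * Xᴴ) (t i)) = m i) →
      (∀ i, 0 < t i) ∧ n₀ + ∑ i, m i = n ∧
        IsEmbeddedSubmanifold (heightCriticalSet (fun x : ℝ => x) X) ∧
        AreDiffeomorphic (heightCriticalSet (fun x : ℝ => x) X)
          (orthogonalMatrices n₀ ℝ ×ˢ
            Set.univ.pi fun i => orthogonalInvolutions (m i) ℝ)) ∧
    (∀ (n : ℕ) (X : Matrix (Fin n) (Fin n) ℂ) (n₀ k : ℕ) (t : Fin k → ℝ) (m : Fin k → ℕ),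
      Module.finrank ℂᵐᵒᵖ (rightKernel X) = n₀ →
      StrictMono t →
      Set.range t = {s : ℝ | s ≠ 0 ∧ realEigenspace (X * Xᴴ) s ≠ ⊥} →
      (∀ i, Module.finrank ℂᵐᵒᵖ (realEigenspace (X * Xᴴ) (t i)) = m i) →
      (∀ i, 0 < t i) ∧ n₀ + ∑ i, m i = n ∧
        IsEmbeddedSubmanifold (heightCriticalSet Complex.re X) ∧
        AreDiffeomorphic (heightCriticalSet Complex.re X)
          (orthogonalMatrices n₀ ℂ ×ˢ
            Set.univ.pi fun i => orthogonalInvolutions (m i) ℂ)) ∧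
    (∀ (n : ℕ) (X : Matrix (Fin n) (Fin n) (Quaternion ℝ)) (n₀ k : ℕ) (t : Fin k → ℝ) (m : Fin k → ℕ),
      Module.finrank (Quaternion ℝ)ᵐᵒᵖ (rightKernel X) = n₀ →
      StrictMono t →
      Set.range t = {s : ℝ | s ≠ 0 ∧ realEigenspace (X * Xᴴ) s ≠ ⊥} →
      (∀ i, Module.finrank (Quaternion ℝ)ᵐᵒᵖ (realEigenspace (X * Xᴴ) (t i)) = m i) →
      (∀ i, 0 < t i) ∧ n₀ + ∑ i, m i = n ∧
        IsEmbeddedSubmanifold (heightCriticalSet (fun q : Quaternion ℝ => q.re) X) ∧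
        AreDiffeomorphic (heightCriticalSet (fun q : Quaternion ℝ => q.re) X)
          (orthogonalMatrices n₀ (Quaternion ℝ) ×ˢ
            Set.univ.pi fun i => orthogonalInvolutions (m i) (Quaternion ℝ))) := by
  exact ⟨fun _ => heightCriticalSet_isEmbeddedSubmanifold_and_areDiffeomorphic isRealPart_real,
    fun _ => heightCriticalSet_isEmbeddedSubmanifold_and_areDiffeomorphic isRealPart_complex,
    fun _ => heightCriticalSet_isEmbeddedSubmanifold_and_areDiffeomorphic isRealPart_quaternion⟩
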